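/- Let $a>0$ and let $M=\mathbb H^2(-a^2)$ be the hyperbolic plane of constant curvature $-a^2$, realised as the open unit disk of $\mathbb R^2$ with the Riemannian metric $g=\dfrac{4\,|dx|^2}{a^2(1-|x|^2)^2}$ and base point $O=0$. Let $S(\infty)$ be its sphere at infinity, that is, the set of geodesic rays from $O$, identified with the unit circle of directions in $T_OM$; $\overline M=M\cup S(\infty)$ carries the cone topology, in which the truncated cones $\{c_w(t): \angle(u,w)<\theta,\ t>R\}$ (with $c_w$ the unit speed geodesic ray from $O$ in direction $w$) are, within $M$, a base of neighbourhoods of $u\in S(\infty)$. Let $\phi\in C^1(S(\infty))$ and let $F\in C^\infty(M)\cap C^0(\overline M)$ be the bounded harmonic function, $\Delta F=\operatorname{div}\nabla F=0$, with $F|_{S(\infty)}=\phi$. Write $\overline\nabla$ for the Levi-Civita connection on $T^*M$, so that $\overline\nabla(dF)$ is the covariant Hessian of $F$; $\overline g$ for the inner product induced by $g$ on $T^*M\otimes T^*M$; and $dV$ for the Riemannian measure. Then $$\int_{M}\overline g\big(\overline\nabla(dF),\overline\nabla(dF)\big)\,dV \;=\; a^2\int_{M}|\nabla F|^2\,dV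 ,$$ and both integrals are finite. -/

import Mathlib

open scoped ContDiff Manifold

/-! Riemannian geometry of a metric given by its coefficient matrix in global coordinates on
an open subset of the plane, and the hyperbolic plane of curvature `-a²` as the unit disk. -/

noncomputable section

namespace HypPlane

/-- The coordinate plane. -/
abbrev E2 : Type := EuclideanSpace ℝ (Fin 2)

/-- A field of `2 × 2` coefficient matrices `g_{ij}(x)` in the coordinates `x¹, x²`. -/
abbrev MetricField : Type := E2 → Matrix (Fin 2) (Fin 2) ℝ

/-- The coordinate partial derivative `∂_i f`. -/
def pd (i : Fin 2) (f : E2 → ℝ) (x : E2) : ℝ :=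
  fderiv ℝ f x (EuclideanSpace.single i 1)

/-- The Christoffel symbol
`Γ^l_{jk} = ½ ∑_m g^{lm} (∂_j g_{mk} + ∂_k g_{mj} - ∂_m g_{jk})` of the Levi-Civita connection. -/
def christoffel (g : MetricField) (l j k : Fin 2) (x : E2) : ℝ :=
  (1 / 2) * ∑ m, (g x)⁻¹ l m *
    (pd j (fun y => g y m k) x + pd k (fun y => g y m j) x - pd m (fun y => g y j k) x)

/-- The components `∂_j F` of the 1-form `dF`. -/
def dForm (F : E2 → ℝ) (x : E2) : Fin 2 → ℝ := fun j => pd j F x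

/-- The components `η_{j;k} = ∂_k η_j - ∑_l Γ^l_{jk} η_l` of the covariant derivative
`∇η` of a 1-form `η = ∑_j η_j dx^j`. -/
def covDeriv (g : MetricField) (η : E2 → Fin 2 → ℝ) (x : E2) : Fin 2 → Fin 2 → ℝ :=
  fun j k => pd k (fun y => η y j) x - ∑ l, christoffel g l j k x * η x l

/-- The inner product induced by `g` on `T*M ⊗ T*M`: `∑ g^{ik} g^{jl} S_{ij} T_{kl}`. -/
def tensorInner (g : MetricField) (x : E2) (S T : Fin 2 → Fin 2 → ℝ) : ℝ :=
  ∑ i, ∑ j, ∑ k, ∑ l, (g x)⁻¹ i k * (g x)⁻¹ j l * S i j * T k l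

/-- The inner product `g_x(X, Y) = ∑ g_{ij} X^i Y^j` of tangent vectors at `x`. -/
def vecInner (g : MetricField) (x : E2) (X Y : Fin 2 → ℝ) : ℝ :=
  ∑ i, ∑ j, g x i j * X i * Y j

/-- The gradient vector field `(∇F)^i = ∑_j g^{ij} ∂_j F`. -/
def grad (g : MetricField) (F : E2 → ℝ) (x : E2) : Fin 2 → ℝ :=
  fun i => ∑ j, (g x)⁻¹ i j * dForm F x j

/-- The divergence `(det g)^{-1/2} ∑_i ∂_i ((det g)^{1/2} X^i)` of a vector field. -/
def divergence (g : MetricField) (X : E2 → Fin 2 → ℝ) (x : E2) : ℝ :=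
  (Real.sqrt (g x).det)⁻¹ * ∑ i, pd i (fun y => Real.sqrt (g y).det * X y i) x

/-- The Laplace-Beltrami operator `ΔF = div ∇F = - d* dF`. -/
def laplacian (g : MetricField) (F : E2 → ℝ) (x : E2) : ℝ :=
  divergence g (grad g F) x

/-- The Riemannian measure `(det g)^{1/2} dx¹ dx²` on the coordinate domain `U`. -/
def riemVolume (g : MetricField) (U : Set E2) : MeasureTheory.Measure E2 :=
  ((MeasureTheory.volume : MeasureTheory.Measure E2).restrict U).withDensity
    (fun x => ENNReal.ofReal (Real.sqrt (g x).det))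

/-- `c : [0, ∞) → U` solves the geodesic equation
`c''^l + ∑_{j,k} Γ^l_{jk}(c) c'^j c'^k = 0` with `c(0) = p`, `c'(0) = X`
(`v` is the velocity field `c'`). -/
def IsGeodesicRay (g : MetricField) (U : Set E2) (p X : E2) (c : ℝ → E2) : Prop :=
  ∃ v : ℝ → E2, c 0 = p ∧ v 0 = X ∧ ∀ t : ℝ, 0 ≤ t →
    c t ∈ U ∧ HasDerivWithinAt c (v t) (Set.Ici 0) t ∧
    ∀ l : Fin 2, HasDerivWithinAt (fun s => v s l)
      (-∑ j, ∑ k, christoffel g l j k (c t) * v t j * v t k) (Set.Ici 0) t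

/-- The open unit disk, the underlying manifold of the hyperbolic plane. -/
def disk : Set E2 := Metric.ball 0 1

/-- The Poincaré metric `4 |dx|² / (a² (1 - |x|²)²)` on the unit disk. It is complete and has
constant curvature `-a²`. -/
def hypMetric (a : ℝ) : MetricField :=
  fun x => (4 / (a ^ 2 * (1 - ‖x‖ ^ 2) ^ 2)) • (1 : Matrix (Fin 2) (Fin 2) ℝ)

/-- The sphere at infinity: geodesic rays from the origin `O`, identified with their initial
directions. At `O` the metric is `4/a²` times the Euclidean one, so the `g_O`-unit tangent
vector with direction `u` (a Euclidean unit vector) is `(a/2) u`, and `g_O`-angles are Euclidean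
angles. -/
abbrev SphereAtInfinity : Type := Metric.sphere (0 : E2) 1

/-- `F` extends continuously by `φ` to the sphere at infinity, in the cone topology: a base of
neighbourhoods (in the disk) of the boundary point `u` is formed by the truncated cones
consisting of the points `c(t)`, where `t > R` and `c` is the unit speed geodesic ray from the
origin in a direction `w` with `∠(u, w) < θ`. -/
def HasBoundaryValues (a : ℝ) (F : E2 → ℝ) (φ : SphereAtInfinity → ℝ) : Prop :=
  ∀ u : SphereAtInfinity, ∀ ε : ℝ, 0 < ε → ∃ θ : ℝ, 0 < θ ∧ ∃ R : ℝ,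
    ∀ w : SphereAtInfinity, InnerProductGeometry.angle (u : E2) (w : E2) < θ →
      ∀ c : ℝ → E2, IsGeodesicRay (hypMetric a) disk 0 ((a / 2) • (w : E2)) c →
        ∀ t : ℝ, 0 ≤ t → R < t → |F (c t) - φ u| < ε

end HypPlane

end

namespace HypPlane

open MeasureTheory Filter Topology
open Real (pi_pos)
open scoped Real

/-- The isometric identification of `ℂ` with the coordinate plane. -/
noncomputable abbrev planeIso : ℂ ≃ₗᵢ[ℝ] E2 := Complex.orthonormalBasisOneI.repr

lemma planeIso_apply_zero (z : ℂ) : planeIso z 0 = z.re := by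
  simp [planeIso, Complex.orthonormalBasisOneI_repr_apply]

lemma planeIso_apply_one (z : ℂ) : planeIso z 1 = z.im := by
  simp [planeIso, Complex.orthonormalBasisOneI_repr_apply]

lemma planeIso_one : planeIso 1 = EuclideanSpace.single 0 1 := by
  ext i; fin_cases i <;> simp [Complex.orthonormalBasisOneI_repr_apply]

lemma planeIso_I : planeIso Complex.I = EuclideanSpace.single 1 1 := by
  ext i; fin_cases i <;> simp [Complex.orthonormalBasisOneI_repr_apply]

lemma planeIso_mem_disk {z : ℂ} : planeIso z ∈ disk ↔ z ∈ Metric.ball (0 : ℂ) 1 := by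
  simp [disk]

lemma fderiv_comp_planeIso (G : E2 → ℝ) (z v : ℂ) :
    fderiv ℝ (fun w => G (planeIso w)) z v = fderiv ℝ G (planeIso z) (planeIso v) := by
  have := planeIso.toContinuousLinearEquiv.comp_right_fderiv (f := G) (x := z)
  have h2 := congrArg (fun L => L v) this
  simpa [Function.comp_def] using h2

lemma pd_zero_eq (G : E2 → ℝ) (z : ℂ) :
    pd 0 G (planeIso z) = fderiv ℝ (fun w => G (planeIso w)) z 1 := by
  rw [fderiv_comp_planeIso, planeIso_one, pd]

lemma pd_one_eq (G : E2 → ℝ) (z : ℂ) :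
    pd 1 G (planeIso z) = fderiv ℝ (fun w => G (planeIso w)) z Complex.I := by
  rw [fderiv_comp_planeIso, planeIso_I, pd]

/-- Partial derivatives of the real part of a complex differentiable function. -/
lemma pd_of_eventuallyEq_re {G : E2 → ℝ} {f : ℂ → ℂ} {f' z : ℂ}
    (h : (fun w => G (planeIso w)) =ᶠ[𝓝 z] fun w => (f w).re) (hf : HasDerivAt f f' z) :
    pd 0 G (planeIso z) = f'.re ∧ pd 1 G (planeIso z) = -f'.im := by
  have h1 := Complex.reCLM.hasFDerivAt.comp z (hf.hasFDerivAt.restrictScalars ℝ)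
  have h2 := (h1.congr_of_eventuallyEq h).fderiv
  rw [pd_zero_eq, pd_one_eq, h2]
  simp

lemma pd_congr {i : Fin 2} {G H : E2 → ℝ} {x : E2} (h : G =ᶠ[𝓝 x] H) : pd i G x = pd i H x := by
  rw [pd, pd, h.fderiv_eq]

/-- The conformal factor of the Poincaré metric. -/
noncomputable def conf (a : ℝ) (x : E2) : ℝ := 4 / (a ^ 2 * (1 - ‖x‖ ^ 2) ^ 2)

lemma one_sub_norm_sq_pos {x : E2} (hx : x ∈ disk) : 0 < 1 - ‖x‖ ^ 2 := by
  have : ‖x‖ < 1 := by simpa [disk] using hx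
  nlinarith [norm_nonneg x]

lemma conf_pos {a : ℝ} (ha : 0 < a) {x : E2} (hx : x ∈ disk) : 0 < conf a x := by
  have := one_sub_norm_sq_pos hx
  unfold conf; positivity

lemma hypMetric_apply (a : ℝ) (x : E2) (i j : Fin 2) :
    hypMetric a x i j = conf a x * (if i = j then 1 else 0) := by
  simp [hypMetric, conf, Matrix.one_apply]

lemma hypMetric_inv_apply {a : ℝ} (ha : 0 < a) {x : E2} (hx : x ∈ disk) (i j : Fin 2) :
    (hypMetric a x)⁻¹ i j = (conf a x)⁻¹ * (if i = j then 1 else 0) := by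
  have h : (hypMetric a x)⁻¹ = (conf a x)⁻¹ • (1 : Matrix (Fin 2) (Fin 2) ℝ) := by
    apply Matrix.inv_eq_right_inv
    have := (conf_pos ha hx).ne'
    change (conf a x • (1 : Matrix (Fin 2) (Fin 2) ℝ)) * _ = _
    simp [smul_smul, this]
  simp [h, Matrix.one_apply]

lemma sqrt_det_hypMetric {a : ℝ} (ha : 0 < a) {x : E2} (hx : x ∈ disk) :
    Real.sqrt (hypMetric a x).det = conf a x := by
  have h : (hypMetric a x).det = conf a x ^ 2 := by
    rw [Matrix.det_fin_two]; simp [hypMetric_apply]; ring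
  rw [h, Real.sqrt_sq (conf_pos ha hx).le]

lemma isOpen_disk : IsOpen disk := Metric.isOpen_ball

lemma disk_mem_nhds {x : E2} (hx : x ∈ disk) : disk ∈ 𝓝 x := isOpen_disk.mem_nhds hx

lemma pd_conf {a : ℝ} (ha : 0 < a) {x : E2} (hx : x ∈ disk) (i : Fin 2) :
    pd i (conf a) x = conf a x * (4 / (1 - ‖x‖ ^ 2)) * x i := by
  have hp := one_sub_norm_sq_pos hx
  have h1 : HasFDerivAt (fun y : E2 => ‖y‖ ^ 2) (2 • innerSL ℝ x) x :=
    (hasStrictFDerivAt_norm_sq x).hasFDerivAt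
  have h2 : HasDerivAt (fun s : ℝ => 4 / (a ^ 2 * (1 - s) ^ 2))
      (8 / (a ^ 2 * (1 - ‖x‖ ^ 2) ^ 3)) (‖x‖ ^ 2) := by
    have h3 : HasDerivAt (fun s : ℝ => a ^ 2 * (1 - s) ^ 2)
        (a ^ 2 * (2 * (1 - ‖x‖ ^ 2) * (-1))) (‖x‖ ^ 2) := by
      have := (((hasDerivAt_id (‖x‖ ^ 2)).const_sub 1).pow 2).const_mul (a ^ 2)
      simpa using this
    have h4 := (h3.inv (by positivity)).const_mul 4
    simp only [div_eq_mul_inv]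
    refine h4.congr_deriv ?_
    field_simp
    norm_num
  have h5 := h2.comp_hasFDerivAt x h1
  have h6 : HasFDerivAt (conf a) _ x := h5
  rw [pd, h6.fderiv]
  simp [EuclideanSpace.inner_single_right, conf]
  field_simp
  ring

lemma christoffel_hypMetric {a : ℝ} (ha : 0 < a) {x : E2} (hx : x ∈ disk) (l j k : Fin 2) :
    christoffel (hypMetric a) l j k x = 2 / (1 - ‖x‖ ^ 2) *
      ((if l = k then 1 else 0) * x j + (if l = j then 1 else 0) * x k
        - (if j = k then 1 else 0) * x l) := by
  have hpd : ∀ i m n : Fin 2, pd i (fun y => hypMetric a y m n) x =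
      conf a x * (4 / (1 - ‖x‖ ^ 2)) * x i * (if m = n then 1 else 0) := by
    intro i m n
    simp only [hypMetric_apply]
    split_ifs
    · simpa using pd_conf ha hx i
    · simp [pd]
  have hc := (conf_pos ha hx).ne'
  have hp := (one_sub_norm_sq_pos hx).ne'
  simp only [christoffel, hpd, hypMetric_inv_apply ha hx, Fin.sum_univ_two]
  fin_cases l <;> fin_cases j <;> fin_cases k <;> simp <;> field_simp <;> ring

lemma grad_hypMetric {a : ℝ} (ha : 0 < a) (F : E2 → ℝ) {x : E2} (hx : x ∈ disk) (i : Fin 2) :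
    grad (hypMetric a) F x i = (conf a x)⁻¹ * pd i F x := by
  simp [grad, hypMetric_inv_apply ha hx, dForm]

lemma laplacian_hypMetric {a : ℝ} (ha : 0 < a) (F : E2 → ℝ) {x : E2} (hx : x ∈ disk) :
    laplacian (hypMetric a) F x = (conf a x)⁻¹ * (pd 0 (pd 0 F) x + pd 1 (pd 1 F) x) := by
  have h : ∀ i : Fin 2, (fun y => Real.sqrt (hypMetric a y).det * grad (hypMetric a) F y i)
      =ᶠ[𝓝 x] pd i F := by
    intro i
    filter_upwards [disk_mem_nhds hx] with y hy
    rw [sqrt_det_hypMetric ha hy, grad_hypMetric ha F hy, mul_inv_cancel_left₀ (conf_pos ha hy).ne']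
  simp only [laplacian, divergence, pd_congr (h _), sqrt_det_hypMetric ha hx, Fin.sum_univ_two]

lemma tensorInner_hypMetric {a : ℝ} (ha : 0 < a) {x : E2} (hx : x ∈ disk)
    (S : Fin 2 → Fin 2 → ℝ) :
    tensorInner (hypMetric a) x S S =
      (conf a x)⁻¹ ^ 2 * (S 0 0 ^ 2 + S 0 1 ^ 2 + S 1 0 ^ 2 + S 1 1 ^ 2) := by
  simp [tensorInner, hypMetric_inv_apply ha hx]
  ring

lemma vecInner_grad_hypMetric {a : ℝ} (ha : 0 < a) (F : E2 → ℝ) {x : E2} (hx : x ∈ disk) :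
    vecInner (hypMetric a) x (grad (hypMetric a) F x) (grad (hypMetric a) F x) =
      (conf a x)⁻¹ * (pd 0 F x ^ 2 + pd 1 F x ^ 2) := by
  have hc := (conf_pos ha hx).ne'
  simp [vecInner, grad_hypMetric ha F hx, hypMetric_apply]
  field_simp

lemma harmonicOnNhd_comp_planeIso {a : ℝ} (ha : 0 < a) {F : E2 → ℝ}
    (hF : ContDiffOn ℝ ∞ F disk) (hh : ∀ x ∈ disk, laplacian (hypMetric a) F x = 0) :
    InnerProductSpace.HarmonicOnNhd (fun z => F (planeIso z)) (Metric.ball (0 : ℂ) 1) := by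
  have hdiff : ∀ z ∈ Metric.ball (0 : ℂ) 1, ContDiffAt ℝ 2 (fun z => F (planeIso z)) z := by
    intro z hz
    have h1 : ContDiffAt ℝ 2 F (planeIso z) :=
      (hF.contDiffAt (disk_mem_nhds (planeIso_mem_disk.2 hz))).of_le (WithTop.coe_le_coe.2 le_top)
    exact h1.comp z planeIso.toContinuousLinearEquiv.contDiff.contDiffAt
  intro z hz
  refine ⟨hdiff z hz, ?_⟩
  filter_upwards [Metric.isOpen_ball.mem_nhds hz] with w hw
  have hd : DifferentiableAt ℝ (fderiv ℝ (fun z => F (planeIso z))) w :=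
    ((hdiff w hw).fderiv_right (m := 1) (by norm_num)).differentiableAt (by norm_num)
  have key : ∀ v : ℂ, fderiv ℝ (fderiv ℝ (fun z => F (planeIso z))) w v v =
      fderiv ℝ (fun u => fderiv ℝ (fun z => F (planeIso z)) u v) w v := by
    intro v
    rw [fderiv_clm_apply hd (differentiableAt_const _)]
    simp
  have hx := hh _ (planeIso_mem_disk.2 hw)
  rw [laplacian_hypMetric ha F (planeIso_mem_disk.2 hw), pd_zero_eq, pd_one_eq] at hx
  simp only [pd_zero_eq, pd_one_eq] at hx
  have hx' := (mul_eq_zero.1 hx).resolve_left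
    (inv_ne_zero (conf_pos ha (planeIso_mem_disk.2 hw)).ne')
  rw [InnerProductSpace.laplacian_eq_iteratedFDeriv_complexPlane]
  simp [iteratedFDeriv_two_apply, key, hx']

/-- The Hessian energy density of `F = Re f` in terms of `f'` and `f''`. -/
lemma hessian_energy_density {a : ℝ} (ha : 0 < a) {F : E2 → ℝ} {f f' f'' : ℂ → ℂ}
    (hF : ∀ z ∈ Metric.ball (0 : ℂ) 1, F (planeIso z) = (f z).re)
    (hf : ∀ z ∈ Metric.ball (0 : ℂ) 1, HasDerivAt f (f' z) z)
    (hf' : ∀ z ∈ Metric.ball (0 : ℂ) 1, HasDerivAt f' (f'' z) z)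
    {z : ℂ} (hz : z ∈ Metric.ball (0 : ℂ) 1) :
    conf a (planeIso z) * tensorInner (hypMetric a) (planeIso z)
        (covDeriv (hypMetric a) (dForm F) (planeIso z))
        (covDeriv (hypMetric a) (dForm F) (planeIso z)) =
      a ^ 2 / 2 * ‖(1 - ‖z‖ ^ 2 : ℝ) * f'' z - 2 * (starRingEnd ℂ) z * f' z‖ ^ 2 := by
  have hx := planeIso_mem_disk.2 hz
  have hnear : ∀ w ∈ Metric.ball (0 : ℂ) 1, Metric.ball (0 : ℂ) 1 ∈ 𝓝 w := fun w hw =>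
    Metric.isOpen_ball.mem_nhds hw
  have hp : ∀ w ∈ Metric.ball (0 : ℂ) 1,
      pd 0 F (planeIso w) = (f' w).re ∧ pd 1 F (planeIso w) = -(f' w).im := fun w hw =>
    pd_of_eventuallyEq_re (by filter_upwards [hnear w hw] with u hu using hF u hu) (hf w hw)
  have h0 := pd_of_eventuallyEq_re (G := pd 0 F) (z := z)
    (by filter_upwards [hnear z hz] with u hu using (hp u hu).1) (hf' z hz)
  have h1 := pd_of_eventuallyEq_re (G := pd 1 F) (z := z) (f := fun w => Complex.I * f' w)
    (by filter_upwards [hnear z hz] with u hu using by simp [(hp u hu).2])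
    ((hf' z hz).const_mul Complex.I)
  have hs : (0 : ℝ) < 1 - ‖z‖ ^ 2 := by simpa using one_sub_norm_sq_pos hx
  rw [tensorInner_hypMetric ha hx]
  simp only [covDeriv, dForm, christoffel_hypMetric ha hx, Fin.sum_univ_two, h0.1, h0.2, h1.1, h1.2,
    (hp z hz).1, (hp z hz).2, planeIso_apply_zero, planeIso_apply_one, conf,
    LinearIsometryEquiv.norm_map]
  generalize f' z = p
  generalize f'' z = q
  generalize 1 - ‖z‖ ^ 2 = s at *
  rw [Complex.sq_norm, Complex.normSq_apply]
  simp
  field_simp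
  ring

lemma gradient_energy_density {a : ℝ} (ha : 0 < a) {F : E2 → ℝ} {f f' : ℂ → ℂ}
    (hF : ∀ z ∈ Metric.ball (0 : ℂ) 1, F (planeIso z) = (f z).re)
    (hf : ∀ z ∈ Metric.ball (0 : ℂ) 1, HasDerivAt f (f' z) z)
    {z : ℂ} (hz : z ∈ Metric.ball (0 : ℂ) 1) :
    conf a (planeIso z) * vecInner (hypMetric a) (planeIso z)
        (grad (hypMetric a) F (planeIso z)) (grad (hypMetric a) F (planeIso z)) = ‖f' z‖ ^ 2 := by
  have hx := planeIso_mem_disk.2 hz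
  have hp := pd_of_eventuallyEq_re (G := F) (z := z)
    (by filter_upwards [Metric.isOpen_ball.mem_nhds hz] with u hu using hF u hu) (hf z hz)
  rw [vecInner_grad_hypMetric ha F hx, mul_inv_cancel_left₀ (conf_pos ha hx).ne', hp.1, hp.2,
    Complex.sq_norm, Complex.normSq_apply]
  ring

lemma hasDerivAt_tanh (x : ℝ) : HasDerivAt Real.tanh (1 - Real.tanh x ^ 2) x := by
  have h := (Real.hasDerivAt_sinh x).div (Real.hasDerivAt_cosh x) (Real.cosh_pos x).ne'
  have e : Real.tanh = fun y => Real.sinh y / Real.cosh y := by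
    funext y; exact Real.tanh_eq_sinh_div_cosh y
  rw [e]
  refine h.congr_deriv ?_
  have := (Real.cosh_pos x).ne'
  field_simp

/-- Unit speed geodesic rays of the Poincaré disk issuing from the origin. -/
lemma isGeodesicRay_tanh {a : ℝ} (ha : 0 < a) (w : SphereAtInfinity) :
    IsGeodesicRay (hypMetric a) disk 0 ((a / 2) • (w : E2))
      (fun t => Real.tanh (a / 2 * t) • (w : E2)) := by
  have hw : ‖(w : E2)‖ = 1 := by simp
  have hd : ∀ t, HasDerivAt (fun t => Real.tanh (a / 2 * t))
      (a / 2 * (1 - Real.tanh (a / 2 * t) ^ 2)) t := by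
    intro t
    have h := (hasDerivAt_tanh (a / 2 * t)).comp t ((hasDerivAt_id t).const_mul (a / 2))
    refine h.congr_deriv ?_
    simp; ring
  refine ⟨fun t => (a / 2 * (1 - Real.tanh (a / 2 * t) ^ 2)) • (w : E2), by simp, by simp, ?_⟩
  intro t _
  have h1 := Real.tanh_lt_one (a / 2 * t)
  have h2 := Real.neg_one_lt_tanh (a / 2 * t)
  have hmem : Real.tanh (a / 2 * t) • (w : E2) ∈ disk := by
    simpa [disk, norm_smul, hw, abs_lt] using ⟨h2, h1⟩
  refine ⟨hmem, ((hd t).smul_const (w : E2)).hasDerivWithinAt, fun l => ?_⟩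
  have h3 : HasDerivAt (fun t => a / 2 * (1 - Real.tanh (a / 2 * t) ^ 2) * (w : E2) l)
      (-(a * Real.tanh (a / 2 * t) * (a / 2 * (1 - Real.tanh (a / 2 * t) ^ 2)) * (w : E2) l)) t := by
    refine (((((hd t).pow 2).const_sub 1).const_mul (a / 2)).mul_const ((w : E2) l)).congr_deriv ?_
    norm_num only [Nat.cast_ofNat, pow_one]
    ring
  refine (h3.congr_deriv ?_).hasDerivWithinAt
  have hw2 : (w : E2) 0 ^ 2 + (w : E2) 1 ^ 2 = 1 := by
    have := EuclideanSpace.norm_sq_eq (w : E2)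
    rw [hw] at this
    simpa [Fin.sum_univ_two] using this.symm
  have hs : 1 - Real.tanh (a / 2 * t) ^ 2 ≠ 0 := by nlinarith
  simp only [christoffel_hypMetric ha hmem, Fin.sum_univ_two, norm_smul, hw, mul_one,
    Real.norm_eq_abs, sq_abs, PiLp.smul_apply, smul_eq_mul]
  generalize Real.tanh (a / 2 * t) = s at *
  fin_cases l <;> simp <;> field_simp
  · linear_combination (s * (w : E2) 0) * hw2
  · linear_combination (s * (w : E2) 1) * hw2

lemma neg_pi_lt_pi : -π < π := neg_lt_self pi_pos

lemma fourierCoeffOn_pi_eq (g : ℝ → ℂ) (k : ℤ) :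
    fourierCoeffOn neg_pi_lt_pi g k =
      (1 / (2 * π)) • ∫ θ in (-π)..π, Complex.exp (-(k * θ * Complex.I)) * g θ := by
  rw [fourierCoeffOn_eq_integral]
  congr 1
  · ring
  · refine intervalIntegral.integral_congr fun θ _ => ?_
    simp only [fourier_coe_apply, smul_eq_mul]
    congr 2
    have : (π : ℂ) ≠ 0 := by exact_mod_cast pi_pos.ne'
    push_cast
    field_simp
    ring

lemma integral_exp_int_mul_I (n : ℤ) :
    ∫ θ in (-π)..π, Complex.exp (n * θ * Complex.I) = if n = 0 then (2 * π : ℂ) else 0 := by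
  split_ifs with h
  · subst h
    simp
    ring
  · have hn : (n : ℂ) * Complex.I ≠ 0 := by simp [h]
    have h1 := integral_exp_mul_complex (a := -π) (b := π) hn
    have h2 : ∀ θ : ℝ, (n : ℂ) * Complex.I * θ = n * θ * Complex.I := fun θ => by ring
    simp only [h2] at h1
    rw [h1]
    have h3 : Complex.exp (n * π * Complex.I) = Complex.exp (n * (-π : ℝ) * Complex.I) := by
      rw [Complex.exp_eq_exp_iff_exists_int]
      exact ⟨n, by push_cast; ring⟩
    rw [h3]; simp

lemma norm_exp_int_mul_I (n : ℤ) (θ : ℝ) : ‖Complex.exp (n * θ * Complex.I)‖ = 1 := by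
  have := Complex.norm_exp_ofReal_mul_I (n * θ)
  push_cast at this
  exact this

/-- The Fourier coefficients of the sum of an absolutely convergent trigonometric series. -/
lemma hasSum_fourierCoeffOn {ι : Type*} [Countable ι] {c : ι → ℂ} (hc : Summable fun i => ‖c i‖)
    (e : ι → ℤ) {g : ℝ → ℂ}
    (hg : ∀ θ : ℝ, HasSum (fun i => c i * Complex.exp (e i * θ * Complex.I)) (g θ)) (k : ℤ) :
    HasSum (fun i => if e i = k then c i else 0) (fourierCoeffOn neg_pi_lt_pi g k) := by
  have key : HasSum
      (fun i => ∫ θ in (-π)..π, Complex.exp (-(k * θ * Complex.I)) *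
        (c i * Complex.exp (e i * θ * Complex.I)))
      (∫ θ in (-π)..π, Complex.exp (-(k * θ * Complex.I)) * g θ) := by
    refine intervalIntegral.hasSum_integral_of_dominated_convergence (fun i _ => ‖c i‖) ?_ ?_ ?_ ?_ ?_
    · intro i
      exact (by fun_prop : Continuous fun θ : ℝ => Complex.exp (-(k * θ * Complex.I)) *
        (c i * Complex.exp (e i * θ * Complex.I))).aestronglyMeasurable
    · intro i
      refine Eventually.of_forall fun θ _ => ?_
      have := norm_exp_int_mul_I (-k) θ
      push_cast at this
      rw [norm_mul, norm_mul, norm_exp_int_mul_I, ← neg_mul, ← neg_mul, this]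
      simp
    · exact Eventually.of_forall fun _ _ => hc
    · exact intervalIntegrable_const
    · exact Eventually.of_forall fun θ _ => (hg θ).mul_left _
  rw [fourierCoeffOn_pi_eq]
  convert key.const_smul (1 / (2 * π)) using 1
  funext i
  have : ∀ θ : ℝ, Complex.exp (-(k * θ * Complex.I)) * (c i * Complex.exp (e i * θ * Complex.I)) =
      c i * Complex.exp ((e i - k : ℤ) * θ * Complex.I) := by
    intro θ
    rw [mul_left_comm, ← Complex.exp_add]
    congr 2
    push_cast; ring
  simp only [this, intervalIntegral.integral_const_mul, integral_exp_int_mul_I, sub_eq_zero]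
  split_ifs
  · have : (π : ℂ) ≠ 0 := by exact_mod_cast pi_pos.ne'
    rw [Complex.real_smul]; push_cast; field_simp
  · simp

/-- Parseval's identity for an absolutely convergent one-sided trigonometric series. -/
lemma lintegral_circle_sq_norm {c : ℕ → ℂ} (hc : Summable fun n => ‖c n‖) {g : ℝ → ℂ}
    (hg : ∀ θ : ℝ, HasSum (fun n : ℕ => c n * Complex.exp (n * θ * Complex.I)) (g θ)) :
    ∫⁻ θ in Set.Ioo (-π) π, ENNReal.ofReal (‖g θ‖ ^ 2) =
      ∑' n, ENNReal.ofReal (2 * π * ‖c n‖ ^ 2) := by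
  have hn : ∀ (n : ℕ) (θ : ℝ), ‖c n * Complex.exp (n * θ * Complex.I)‖ ≤ ‖c n‖ := fun n θ => by
    have := norm_exp_int_mul_I n θ
    push_cast at this
    simp [this]
  have hgc : Continuous g := by
    have h1 : g = fun θ : ℝ => ∑' n : ℕ, c n * Complex.exp (n * θ * Complex.I) :=
      funext fun θ => (hg θ).tsum_eq.symm
    rw [h1]
    exact continuous_tsum (fun n => by fun_prop) hc hn
  have hbd : ∀ θ, ‖g θ‖ ≤ ∑' n, ‖c n‖ := fun θ => by
    rw [← (hg θ).tsum_eq]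
    exact tsum_of_norm_bounded hc.hasSum (fun n => hn n θ)
  have hL2 : MemLp g 2 (volume.restrict (Set.Ioc (-π) π)) :=
    MemLp.of_bound hgc.aestronglyMeasurable _ (Eventually.of_forall hbd)
  have h1 := hasSum_sq_fourierCoeffOn neg_pi_lt_pi hL2
  have hcoef : ∀ k : ℤ, HasSum (fun n : ℕ => if (n : ℤ) = k then c n else 0)
      (fourierCoeffOn neg_pi_lt_pi g k) := fun k =>
    hasSum_fourierCoeffOn hc (fun n : ℕ => (n : ℤ)) (by simpa using hg) k
  have hpos : ∀ n : ℕ, fourierCoeffOn neg_pi_lt_pi g n = c n := fun n =>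
    (hcoef n).unique (by
      simpa using hasSum_single (f := fun m : ℕ => if (m : ℤ) = n then c m else 0) n
        (fun m hm => by simp [hm]))
  have hneg : ∀ k : ℤ, k ∉ Set.range ((↑) : ℕ → ℤ) → fourierCoeffOn neg_pi_lt_pi g k = 0 := by
    intro k hk
    refine (hcoef k).unique ?_
    have : ∀ n : ℕ, (n : ℤ) ≠ k := fun n h => hk ⟨n, h⟩
    simp [this, hasSum_zero]
  have h2 := (Function.Injective.hasSum_iff (Nat.cast_injective (R := ℤ))
    (fun k hk => by simp [hneg k hk])).2 h1
  have h3 : HasSum (fun n => 2 * π * ‖c n‖ ^ 2) (∫ θ in (-π)..π, ‖g θ‖ ^ 2) := by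
    have h4 := h2.mul_left (2 * π)
    simp only [Function.comp_def, hpos, smul_eq_mul] at h4
    rwa [sub_neg_eq_add, ← two_mul, mul_inv_cancel_left₀ (by positivity)] at h4
  rw [← ENNReal.ofReal_tsum_of_nonneg (fun n => by positivity) h3.summable, h3.tsum_eq,
    intervalIntegral.integral_of_le neg_pi_lt_pi.le, integral_Ioc_eq_integral_Ioo]
  refine (ofReal_integral_eq_lintegral_ofReal ?_ ?_).symm
  · exact ((by fun_prop : Continuous fun θ => ‖g θ‖ ^ 2).integrableOn_Icc).mono_set
      Set.Ioo_subset_Icc_self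
  · exact Eventually.of_forall fun θ => by positivity

/-- Polar coordinates in the unit disk. -/
lemma lintegral_ball_polar {H : ℂ → ℂ} (hH : ContinuousOn H (Metric.ball 0 1)) :
    ∫⁻ z in Metric.ball (0 : ℂ) 1, ENNReal.ofReal (‖H z‖ ^ 2) =
      ∫⁻ r in Set.Ioo (0 : ℝ) 1, ENNReal.ofReal r *
        ∫⁻ θ in Set.Ioo (-π) π, ENNReal.ofReal (‖H (r * Complex.exp (θ * Complex.I))‖ ^ 2) := by
  classical
  set K : ℂ → ℂ := (Metric.ball (0 : ℂ) 1).piecewise H 0 with hK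
  have hKm : Measurable K :=
    hH.measurable_piecewise continuousOn_const Metric.isOpen_ball.measurableSet
  have hKin : ∀ z ∈ Metric.ball (0 : ℂ) 1, K z = H z := fun z hz => Set.piecewise_eq_of_mem _ _ _ hz
  have hKout : ∀ z ∉ Metric.ball (0 : ℂ) 1, K z = 0 := fun z hz =>
    Set.piecewise_eq_of_notMem _ _ _ hz
  have h1 : ∫⁻ z in Metric.ball (0 : ℂ) 1, ENNReal.ofReal (‖H z‖ ^ 2) =
      ∫⁻ z, ENNReal.ofReal (‖K z‖ ^ 2) := by
    rw [← lintegral_indicator Metric.isOpen_ball.measurableSet]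
    refine lintegral_congr fun z => ?_
    by_cases hz : z ∈ Metric.ball (0 : ℂ) 1
    · rw [Set.indicator_of_mem hz, hKin z hz]
    · rw [Set.indicator_of_notMem hz, hKout z hz]; simp
  have hpol : ∀ p : ℝ × ℝ, Complex.polarCoord.symm p = p.1 * Complex.exp (p.2 * Complex.I) := by
    intro p
    rw [Complex.polarCoord_symm_apply, Complex.exp_mul_I]
    push_cast; rfl
  rw [h1, ← Complex.lintegral_comp_polarCoord_symm, polarCoord_target, Measure.volume_eq_prod,
    ← Measure.prod_restrict]
  simp only [hpol, smul_eq_mul]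
  rw [lintegral_prod _ (by fun_prop)]
  have h2 : ∀ r : ℝ, ∫⁻ θ in Set.Ioo (-π) π, ENNReal.ofReal r *
      ENNReal.ofReal (‖K (r * Complex.exp (θ * Complex.I))‖ ^ 2) = ENNReal.ofReal r *
      ∫⁻ θ in Set.Ioo (-π) π, ENNReal.ofReal (‖K (r * Complex.exp (θ * Complex.I))‖ ^ 2) :=
    fun r => lintegral_const_mul _ (by fun_prop)
  simp only [h2]
  rw [← lintegral_indicator measurableSet_Ioi, ← lintegral_indicator measurableSet_Ioo]
  refine lintegral_congr fun r => ?_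
  by_cases hr : r ∈ Set.Ioo (0 : ℝ) 1
  · rw [Set.indicator_of_mem hr, Set.indicator_of_mem (Set.mem_Ioi.2 hr.1)]
    congr 1
    refine lintegral_congr fun θ => ?_
    rw [hKin]
    simpa [Complex.norm_exp_ofReal_mul_I, abs_of_pos hr.1] using hr.2
  · rw [Set.indicator_of_notMem hr]
    by_cases hr0 : r ∈ Set.Ioi (0 : ℝ)
    · rw [Set.indicator_of_mem hr0]
      have hr1 : 1 ≤ r := not_lt.1 fun h => hr ⟨hr0, h⟩
      have : ∀ θ : ℝ, K (r * Complex.exp (θ * Complex.I)) = 0 := fun θ => hKout _ (by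
        simpa [Complex.norm_exp_ofReal_mul_I, abs_of_pos (lt_of_lt_of_le one_pos hr1)] using hr1)
      simp [this]
    · rw [Set.indicator_of_notMem hr0]

/-- The squared `L²` norm on the disk of a function given on circles by orthogonal series. -/
lemma lintegral_ball_sq_norm_of_hasSum {H : ℂ → ℂ} (hH : ContinuousOn H (Metric.ball 0 1))
    {B : ℕ → ℂ} {p : ℕ → ℝ → ℝ} (hp : ∀ n, Continuous (p n)) {m : ℕ → ℝ}
    (hm : ∀ n, ∫ r in (0 : ℝ)..1, r * p n r ^ 2 = m n)
    (hsum : ∀ r ∈ Set.Ioo (0 : ℝ) 1, ∀ θ : ℝ, ∃ u : ℂ, ‖u‖ = 1 ∧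
      HasSum (fun n : ℕ => B n * p n r * Complex.exp (n * θ * Complex.I))
        (u * H (r * Complex.exp (θ * Complex.I)))) :
    ∫⁻ z in Metric.ball (0 : ℂ) 1, ENNReal.ofReal (‖H z‖ ^ 2) =
      ∑' n, ENNReal.ofReal (2 * π * ‖B n‖ ^ 2 * m n) := by
  rw [lintegral_ball_polar hH]
  have h1 : ∀ r ∈ Set.Ioo (0 : ℝ) 1, ENNReal.ofReal r * ∫⁻ θ in Set.Ioo (-π) π,
      ENNReal.ofReal (‖H (r * Complex.exp (θ * Complex.I))‖ ^ 2) =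
      ∑' n, ENNReal.ofReal (2 * π * ‖B n‖ ^ 2 * (r * p n r ^ 2)) := by
    intro r hr
    choose u hu hs using hsum r hr
    have hc : Summable fun n => ‖B n * p n r‖ := by
      simpa using (hs 0).summable.norm
    have h2 := lintegral_circle_sq_norm hc hs
    simp only [norm_mul, hu, one_mul] at h2
    rw [h2, ← ENNReal.tsum_mul_left]
    refine tsum_congr fun n => ?_
    rw [← ENNReal.ofReal_mul hr.1.le]
    congr 1
    rw [Complex.norm_real, Real.norm_eq_abs, mul_pow, sq_abs]
    ring
  rw [setLIntegral_congr_fun measurableSet_Ioo h1, lintegral_tsum]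
  · refine tsum_congr fun n => ?_
    have hc : Continuous fun r => 2 * π * ‖B n‖ ^ 2 * (r * p n r ^ 2) := by fun_prop
    rw [← ofReal_integral_eq_lintegral_ofReal, ← integral_Ioc_eq_integral_Ioo,
      ← intervalIntegral.integral_of_le zero_le_one, intervalIntegral.integral_const_mul, hm]
    · exact hc.integrableOn_Icc.mono_set Set.Ioo_subset_Icc_self
    · filter_upwards [ae_restrict_mem measurableSet_Ioo] with r hr
      have := hr.1.le
      positivity
  · intro n
    fun_prop

/-- Taylor expansions of `f`, `f'` and `f''` in the unit disk. -/
lemma exists_hasSum_deriv {f : ℂ → ℂ} (hf : DifferentiableOn ℂ f (Metric.ball 0 1)) :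
    ∃ A : ℕ → ℂ, ∀ z ∈ Metric.ball (0 : ℂ) 1, HasSum (fun n => A n * z ^ n) (f z) ∧
      HasSum (fun n : ℕ => ((n + 1 : ℕ) * A (n + 1)) * z ^ n) (deriv f z) ∧
      HasSum (fun n : ℕ => ((n + 1 : ℕ) * ((n + 2 : ℕ) * A (n + 2))) * z ^ n)
        (deriv (deriv f) z) := by
  have hf1 := hf.deriv Metric.isOpen_ball
  have hf2 := hf1.deriv Metric.isOpen_ball
  refine ⟨fun n => (n.factorial : ℂ)⁻¹ * iteratedDeriv n f 0, fun z hz => ⟨?_, ?_, ?_⟩⟩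
  · convert! Complex.hasSum_taylorSeries_on_ball hf hz using 2 with n
    simp; ring
  · convert! Complex.hasSum_taylorSeries_on_ball hf1 hz using 2 with n
    rw [← iteratedDeriv_succ']
    dsimp only
    rw [Nat.factorial_succ]
    have h1 : ((n + 1 : ℕ) : ℂ) ≠ 0 := Nat.cast_ne_zero.2 n.succ_ne_zero
    have h2 : (n.factorial : ℂ) ≠ 0 := Nat.cast_ne_zero.2 n.factorial_ne_zero
    simp only [Nat.cast_mul, sub_zero, smul_eq_mul]
    field_simp
  · convert! Complex.hasSum_taylorSeries_on_ball hf2 hz using 2 with n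
    rw [← iteratedDeriv_succ', ← iteratedDeriv_succ']
    dsimp only
    rw [Nat.factorial_succ, Nat.factorial_succ]
    have h1 : ((n + 1 : ℕ) : ℂ) ≠ 0 := Nat.cast_ne_zero.2 n.succ_ne_zero
    have h3 : ((n + 1 + 1 : ℕ) : ℂ) ≠ 0 := Nat.cast_ne_zero.2 (n + 1).succ_ne_zero
    have h2 : (n.factorial : ℂ) ≠ 0 := Nat.cast_ne_zero.2 n.factorial_ne_zero
    simp only [Nat.cast_mul, sub_zero, smul_eq_mul]
    field_simp

lemma mul_exp_mem_ball {r : ℝ} (hr : r ∈ Set.Ioo (0 : ℝ) 1) (θ : ℝ) :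
    (r * Complex.exp (θ * Complex.I) : ℂ) ∈ Metric.ball (0 : ℂ) 1 := by
  simpa [Complex.norm_exp_ofReal_mul_I, abs_of_pos hr.1] using hr.2

lemma mul_exp_pow (r θ : ℝ) (n : ℕ) : (r * Complex.exp (θ * Complex.I) : ℂ) ^ n =
    r ^ n * Complex.exp (n * θ * Complex.I) := by
  rw [mul_pow, ← Complex.exp_nat_mul]; congr 2; ring

/-- Positive Fourier coefficients on circles of the real part of a power series. -/
lemma fourierCoeffOn_re_circle {A : ℕ → ℂ} {f : ℂ → ℂ}
    (hA : ∀ z ∈ Metric.ball (0 : ℂ) 1, HasSum (fun n => A n * z ^ n) (f z))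
    {r : ℝ} (hr : r ∈ Set.Ioo (0 : ℝ) 1) {k : ℕ} (hk : k ≠ 0) :
    fourierCoeffOn neg_pi_lt_pi
      (fun θ => ((f (r * Complex.exp (θ * Complex.I))).re : ℂ)) k = A k * r ^ k / 2 := by
  let c : ℕ ⊕ ℕ → ℂ := Sum.elim (fun n => A n * r ^ n / 2)
    (fun n => (starRingEnd ℂ) (A n * r ^ n / 2))
  let e : ℕ ⊕ ℕ → ℤ := Sum.elim (fun n => n) (fun n => -n)
  have hs0 : Summable fun n => ‖A n * (r : ℂ) ^ n / 2‖ := by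
    have := (hA _ (mul_exp_mem_ball hr 0)).summable.norm
    simpa using this.div_const 2
  have hc : Summable fun i => ‖c i‖ := by
    refine Summable.sum _ hs0 ?_
    simpa [c, Function.comp_def] using hs0
  have hg : ∀ θ : ℝ, HasSum (fun i => c i * Complex.exp (e i * θ * Complex.I))
      ((f (r * Complex.exp (θ * Complex.I))).re : ℂ) := by
    intro θ
    have h1 : HasSum (fun n : ℕ => A n * r ^ n / 2 * Complex.exp (n * θ * Complex.I))
        (f (r * Complex.exp (θ * Complex.I)) / 2) := by
      convert! (hA _ (mul_exp_mem_ball hr θ)).div_const 2 using 2 with n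
      rw [mul_exp_pow]; ring
    have h2 := Complex.hasSum_conj'.2 h1
    rw [Complex.re_eq_add_conj, add_div]
    refine HasSum.sum ?_ ?_
    · simpa [c, e, Function.comp_def] using h1
    · convert! h2 using 1
      · funext n
        simp [c, e, ← Complex.exp_conj]
      · rw [map_div₀, map_ofNat]
  have h := hasSum_fourierCoeffOn hc e hg k
  refine h.unique ?_
  have h3 := hasSum_single (f := fun i => if e i = k then c i else 0) (Sum.inl k) (by
    rintro (n | n) hn
    · simp [e]
      intro h
      exact absurd (by rw [h]) hn
    · simp [e]
      intro h
      omega)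
  simpa [e, c] using h3

/-- A bounded harmonic function with `C¹` boundary values has square summable
Taylor coefficients of the derivative. -/
lemma summable_sq_deriv_coeff {A : ℕ → ℂ} {f : ℂ → ℂ}
    (hf : ContinuousOn f (Metric.ball 0 1))
    (hA : ∀ z ∈ Metric.ball (0 : ℂ) 1, HasSum (fun n => A n * z ^ n) (f z))
    {C : ℝ} (hC : ∀ z ∈ Metric.ball (0 : ℂ) 1, |(f z).re| ≤ C)
    {ψ : ℝ → ℝ} (hψ : ContDiff ℝ 1 ψ) (hper : ψ π = ψ (-π))
    (hlim : ∀ θ : ℝ, Tendsto (fun r : ℝ => (f (r * Complex.exp (θ * Complex.I))).re)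
      (𝓝[<] 1) (𝓝 (ψ θ))) :
    Summable fun n : ℕ => ‖((n + 1 : ℕ) * A (n + 1) : ℂ)‖ ^ 2 := by
  have hev : ∀ᶠ r : ℝ in 𝓝[<] 1, r ∈ Set.Ioo (0 : ℝ) 1 := Ioo_mem_nhdsLT zero_lt_one
  have hcoef : ∀ k : ℕ, k ≠ 0 →
      fourierCoeffOn neg_pi_lt_pi (fun θ => (ψ θ : ℂ)) k = A k / 2 := by
    intro k hk
    have h1 : Tendsto (fun r : ℝ => fourierCoeffOn neg_pi_lt_pi
        (fun θ => ((f (r * Complex.exp (θ * Complex.I))).re : ℂ)) k) (𝓝[<] 1)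
        (𝓝 (fourierCoeffOn neg_pi_lt_pi (fun θ => (ψ θ : ℂ)) k)) := by
      simp only [fourierCoeffOn_pi_eq]
      refine Tendsto.const_smul ?_ _
      refine intervalIntegral.tendsto_integral_filter_of_dominated_convergence (fun _ => C)
        ?_ ?_ intervalIntegrable_const ?_
      · filter_upwards [hev] with r hr
        have : Continuous fun θ : ℝ => f (r * Complex.exp (θ * Complex.I)) :=
          hf.comp_continuous (by fun_prop) fun θ => mul_exp_mem_ball hr θ
        have h4 := Complex.continuous_ofReal.comp (Complex.continuous_re.comp this)
        exact ((by fun_prop : Continuous fun θ : ℝ =>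
          Complex.exp (-((k : ℤ) * θ * Complex.I))).mul h4).aestronglyMeasurable
      · filter_upwards [hev] with r hr
        refine Eventually.of_forall fun θ _ => ?_
        have h2 := norm_exp_int_mul_I (-k) θ
        push_cast at h2
        rw [norm_mul, ← neg_mul, ← neg_mul]
        push_cast
        rw [h2, one_mul, Complex.norm_real]
        exact hC _ (mul_exp_mem_ball hr θ)
      · refine Eventually.of_forall fun θ _ => Tendsto.const_mul _ ?_
        exact (Complex.continuous_ofReal.tendsto _).comp (hlim θ)
    have h2 : Tendsto (fun r : ℝ => fourierCoeffOn neg_pi_lt_pi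
        (fun θ => ((f (r * Complex.exp (θ * Complex.I))).re : ℂ)) k) (𝓝[<] 1)
        (𝓝 (A k / 2)) := by
      have h3 : Tendsto (fun r : ℝ => A k * (r : ℂ) ^ k / 2) (𝓝[<] 1) (𝓝 (A k / 2)) := by
        have : Continuous fun r : ℝ => A k * (r : ℂ) ^ k / 2 := by fun_prop
        simpa using (this.tendsto 1).mono_left nhdsWithin_le_nhds
      refine h3.congr' ?_
      filter_upwards [hev] with r hr
      exact (fourierCoeffOn_re_circle hA hr hk).symm
    exact tendsto_nhds_unique h1 h2
  have hd : Continuous (deriv ψ) := hψ.continuous_deriv le_rfl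
  have hdc : Continuous fun θ => ((deriv ψ θ : ℝ) : ℂ) := Complex.continuous_ofReal.comp hd
  have hL2 : MemLp (fun θ => ((deriv ψ θ : ℝ) : ℂ)) 2 (volume.restrict (Set.Ioc (-π) π)) := by
    obtain ⟨K, hK⟩ := isCompact_Icc.exists_bound_of_continuousOn (s := Set.Icc (-π) π)
      hdc.continuousOn
    refine MemLp.of_bound hdc.aestronglyMeasurable K ?_
    filter_upwards [ae_restrict_mem measurableSet_Ioc] with θ hθ
      using hK θ (Set.Ioc_subset_Icc_self hθ)
  have hsum := (hasSum_sq_fourierCoeffOn neg_pi_lt_pi hL2).summable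
  have hinj : Function.Injective fun n : ℕ => ((n + 1 : ℕ) : ℤ) := fun m n h => by
    simpa using h
  have hsum2 := (hsum.comp_injective hinj).mul_left 4
  refine hsum2.congr fun n => ?_
  have hn : ((n + 1 : ℕ) : ℤ) ≠ 0 := by exact_mod_cast n.succ_ne_zero
  have h1 := fourierCoeffOn_of_hasDerivAt neg_pi_lt_pi (f := fun θ => (ψ θ : ℂ))
    (f' := fun θ => ((deriv ψ θ : ℝ) : ℂ)) hn
    (fun θ _ => ((hψ.differentiable one_ne_zero θ).hasDerivAt).ofReal_comp)
    (hdc.intervalIntegrable _ _)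
  rw [hcoef (n + 1) n.succ_ne_zero, hper] at h1
  have h2 : ((n + 1 : ℕ) * A (n + 1) : ℂ) * Complex.I =
      2 * fourierCoeffOn neg_pi_lt_pi (fun θ => ((deriv ψ θ : ℝ) : ℂ)) (n + 1 : ℕ) := by
    have hA' : A (n + 1) = 2 * (A (n + 1) / 2) := by ring
    have hn' : ((n : ℂ) + 1) ≠ 0 := by exact_mod_cast n.succ_ne_zero
    have hpi : (π : ℂ) ≠ 0 := by exact_mod_cast pi_pos.ne'
    rw [hA', h1]
    push_cast
    field_simp
    ring
  have h3 := congrArg norm h2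
  rw [norm_mul, Complex.norm_I, mul_one] at h3
  rw [h3, norm_mul, mul_pow]
  norm_num

lemma tendsto_radial {a : ℝ} (ha : 0 < a) {F : E2 → ℝ} {φ : SphereAtInfinity → ℝ}
    (h : HasBoundaryValues a F φ) (w : SphereAtInfinity) :
    Tendsto (fun r : ℝ => F (r • (w : E2))) (𝓝[<] 1) (𝓝 (φ w)) := by
  have hw : (w : E2) ≠ 0 := ne_zero_of_mem_unit_sphere w
  rw [Metric.tendsto_nhds]
  intro ε hε
  obtain ⟨θ, hθ, R, hR⟩ := h w ε hε
  have hR' := hR w (by rwa [InnerProductGeometry.angle_self hw]) _ (isGeodesicRay_tanh ha w)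
  have hmem : Set.Ioo (Real.tanh (a / 2 * max R 0)) 1 ∈ 𝓝[<] (1 : ℝ) :=
    Ioo_mem_nhdsLT (Real.tanh_lt_one _)
  filter_upwards [hmem] with r hr
  have h1 : Real.tanh (a / 2 * max R 0) ∈ Set.Ioo (-1 : ℝ) 1 :=
    ⟨Real.neg_one_lt_tanh _, Real.tanh_lt_one _⟩
  have h2 : r ∈ Set.Ioo (-1 : ℝ) 1 := ⟨h1.1.trans hr.1, hr.2⟩
  have h3 := Real.strictMonoOn_artanh h1 h2 hr.1
  rw [Real.artanh_tanh] at h3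
  have h4 : max R 0 < 2 / a * Real.artanh r := by
    rw [div_mul_eq_mul_div, lt_div_iff₀ ha]; linarith
  have h5 : a / 2 * (2 / a * Real.artanh r) = Real.artanh r := by field_simp
  have h6 := hR' (2 / a * Real.artanh r) ((le_max_right R 0).trans h4.le)
    ((le_max_left R 0).trans_lt h4)
  rw [h5, Real.tanh_artanh h2] at h6
  simpa [Real.dist_eq] using h6

/-- The boundary point of direction `e^{iθ}`. -/
noncomputable def boundaryPoint (θ : ℝ) : SphereAtInfinity :=
  ⟨planeIso (Complex.exp (θ * Complex.I)), by simp [Complex.norm_exp_ofReal_mul_I]⟩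

lemma contDiff_comp_boundaryPoint {φ : SphereAtInfinity → ℝ}
    (hφ : ContMDiff (𝓡 1) 𝓘(ℝ, ℝ) 1 φ) : ContDiff ℝ 1 fun θ => φ (boundaryPoint θ) := by
  have h1 : ContDiff ℝ 1 fun θ : ℝ => planeIso (Complex.exp (θ * Complex.I)) := by
    refine planeIso.toContinuousLinearEquiv.contDiff.comp ?_
    exact (Complex.ofRealCLM.contDiff.mul contDiff_const).cexp
  have : Fact (Module.finrank ℝ E2 = 1 + 1) := ⟨finrank_euclideanSpace_fin⟩
  have h2 : ContMDiff 𝓘(ℝ, ℝ) (𝓡 1) 1 boundaryPoint :=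
    ContMDiff.codRestrict_sphere (n := 1) h1.contMDiff
      (fun θ => by simp [Complex.norm_exp_ofReal_mul_I])
  exact contMDiff_iff_contDiff.1 (hφ.comp h2)

lemma integral_mul_pow_sq (n : ℕ) :
    ∫ r in (0 : ℝ)..1, r * (r ^ n) ^ 2 = 1 / (2 * (n + 1)) := by
  have : ∀ r : ℝ, r * (r ^ n) ^ 2 = r ^ (2 * n + 1) := fun r => by ring
  simp only [this, integral_pow]
  push_cast
  simp
  rw [← mul_inv]
  ring

/-- The radial factor of the coefficient of `e^{inθ}` in the Hessian. -/
noncomputable def hessRadial (n : ℕ) (r : ℝ) : ℝ :=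
  n * r ^ (n - 1) * (1 - r ^ 2) - 2 * r ^ (n + 1)

lemma integral_mul_hessRadial_sq (n : ℕ) :
    ∫ r in (0 : ℝ)..1, r * hessRadial n r ^ 2 = 1 / (n + 1) := by
  rcases n with _ | m
  · have : ∀ r : ℝ, r * hessRadial 0 r ^ 2 = 4 * r ^ 3 := fun r => by simp [hessRadial]; ring
    simp only [this, intervalIntegral.integral_const_mul, integral_pow]
    norm_num
  · have : ∀ r : ℝ, r * hessRadial (m + 1) r ^ 2 = (m + 1 : ℝ) ^ 2 * r ^ (2 * m + 1) -
        2 * (m + 1) * (m + 3) * r ^ (2 * m + 3) + (m + 3 : ℝ) ^ 2 * r ^ (2 * m + 5) := fun r => by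
      simp [hessRadial]; ring
    simp only [this]
    rw [intervalIntegral.integral_add, intervalIntegral.integral_sub]
    · simp only [intervalIntegral.integral_const_mul, integral_pow]
      push_cast
      simp
      have h1 : (2 * (m : ℝ) + 1 + 1) ≠ 0 := by positivity
      have h2 : (2 * (m : ℝ) + 3 + 1) ≠ 0 := by positivity
      have h3 : (2 * (m : ℝ) + 5 + 1) ≠ 0 := by positivity
      have h4 : ((m : ℝ) + 1 + 1) ≠ 0 := by positivity
      field_simp
      ring
    all_goals exact Continuous.intervalIntegrable (by fun_prop) _ _

lemma measurable_conf (a : ℝ) : Measurable (conf a) := by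
  unfold conf; fun_prop

/-- Integration against the Riemannian measure in the complex coordinate. -/
lemma riemVolume_transfer {a : ℝ} (ha : 0 < a) {Φ : E2 → ℝ} {Q : ℂ → ℝ}
    (h : ∀ z ∈ Metric.ball (0 : ℂ) 1, conf a (planeIso z) * Φ (planeIso z) = Q z) :
    (Integrable Φ (riemVolume (hypMetric a) disk) ↔ IntegrableOn Q (Metric.ball 0 1)) ∧
    ∫ x, Φ x ∂(riemVolume (hypMetric a) disk) = ∫ z in Metric.ball (0 : ℂ) 1, Q z := by
  have hm : riemVolume (hypMetric a) disk =
      (volume.restrict disk).withDensity fun x => ENNReal.ofReal (conf a x) := by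
    refine withDensity_congr_ae ?_
    filter_upwards [ae_restrict_mem isOpen_disk.measurableSet] with x hx
    rw [sqrt_det_hypMetric ha hx]
  have hmeas : Measurable fun x => ENNReal.ofReal (conf a x) := (measurable_conf a).ennreal_ofReal
  have hfin : ∀ᵐ x ∂((volume : Measure E2).restrict disk), ENNReal.ofReal (conf a x) < ⊤ :=
    Eventually.of_forall fun x => ENNReal.ofReal_lt_top
  have hpre : planeIso ⁻¹' disk = Metric.ball (0 : ℂ) 1 := by
    ext z; exact planeIso_mem_disk
  have hmp : MeasurePreserving planeIso volume volume := planeIso.measurePreserving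
  have hemb : MeasurableEmbedding planeIso :=
    planeIso.toHomeomorph.measurableEmbedding
  have hcongr : ∀ z ∈ Metric.ball (0 : ℂ) 1,
      (ENNReal.ofReal (conf a (planeIso z))).toReal • Φ (planeIso z) = Q z := fun z hz => by
    rw [ENNReal.toReal_ofReal (conf_pos ha (planeIso_mem_disk.2 hz)).le, smul_eq_mul, h z hz]
  rw [hm]
  constructor
  · rw [integrable_withDensity_iff_integrable_smul' hmeas hfin]
    have h1 := hmp.integrableOn_comp_preimage hemb
      (f := fun x => (ENNReal.ofReal (conf a x)).toReal • Φ x) (s := disk)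
    rw [hpre] at h1
    exact h1.symm.trans (integrableOn_congr_fun hcongr Metric.isOpen_ball.measurableSet)
  · rw [integral_withDensity_eq_integral_toReal_smul hmeas hfin,
      ← hmp.setIntegral_preimage_emb hemb, hpre]
    exact setIntegral_congr_fun Metric.isOpen_ball.measurableSet hcongr

lemma integrableOn_and_integral_of_lintegral {H : ℂ → ℂ}
    (hH : ContinuousOn H (Metric.ball 0 1))
    (hfin : ∫⁻ z in Metric.ball (0 : ℂ) 1, ENNReal.ofReal (‖H z‖ ^ 2) ≠ ⊤) :
    IntegrableOn (fun z => ‖H z‖ ^ 2) (Metric.ball 0 1) ∧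
    ∫ z in Metric.ball (0 : ℂ) 1, ‖H z‖ ^ 2 =
      (∫⁻ z in Metric.ball (0 : ℂ) 1, ENNReal.ofReal (‖H z‖ ^ 2)).toReal := by
  have hm : AEStronglyMeasurable (fun z => ‖H z‖ ^ 2)
      (volume.restrict (Metric.ball (0 : ℂ) 1)) :=
    (hH.norm.pow 2).aestronglyMeasurable Metric.isOpen_ball.measurableSet
  have hnn : 0 ≤ᵐ[volume.restrict (Metric.ball (0 : ℂ) 1)] fun z => ‖H z‖ ^ 2 :=
    Eventually.of_forall fun z => by positivity
  refine ⟨⟨hm, ?_⟩, integral_eq_lintegral_of_nonneg_ae hnn hm⟩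
  rw [hasFiniteIntegral_iff_ofReal hnn]
  exact hfin.lt_top

/-- The holomorphic form of the identity between the Hessian energy and the Dirichlet energy. -/
lemma holomorphic_energy_identity {f : ℂ → ℂ} (hf : DifferentiableOn ℂ f (Metric.ball 0 1))
    {C : ℝ} (hC : ∀ z ∈ Metric.ball (0 : ℂ) 1, |(f z).re| ≤ C)
    {ψ : ℝ → ℝ} (hψ : ContDiff ℝ 1 ψ) (hper : ψ π = ψ (-π))
    (hlim : ∀ θ : ℝ, Tendsto (fun r : ℝ => (f (r * Complex.exp (θ * Complex.I))).re)
      (𝓝[<] 1) (𝓝 (ψ θ))) :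
    IntegrableOn (fun z => ‖(1 - ‖z‖ ^ 2 : ℝ) * deriv (deriv f) z -
      2 * (starRingEnd ℂ) z * deriv f z‖ ^ 2) (Metric.ball 0 1) ∧
    IntegrableOn (fun z => ‖deriv f z‖ ^ 2) (Metric.ball 0 1) ∧
    ∫ z in Metric.ball (0 : ℂ) 1, ‖(1 - ‖z‖ ^ 2 : ℝ) * deriv (deriv f) z -
      2 * (starRingEnd ℂ) z * deriv f z‖ ^ 2 =
    2 * ∫ z in Metric.ball (0 : ℂ) 1, ‖deriv f z‖ ^ 2 := by
  obtain ⟨A, hA⟩ := exists_hasSum_deriv hf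
  have hsq := summable_sq_deriv_coeff hf.continuousOn (fun z hz => (hA z hz).1) hC hψ hper hlim
  set B : ℕ → ℂ := fun n => ((n + 1 : ℕ) * A (n + 1) : ℂ) with hB
  have hf1 := hf.deriv Metric.isOpen_ball
  have hf2 := hf1.deriv Metric.isOpen_ball
  have hc1 : ContinuousOn (deriv f) (Metric.ball 0 1) := hf1.continuousOn
  have hc2 : ContinuousOn (fun z => (1 - ‖z‖ ^ 2 : ℝ) * deriv (deriv f) z -
      2 * (starRingEnd ℂ) z * deriv f z) (Metric.ball 0 1) := by
    have h1 : Continuous fun z : ℂ => ((1 - ‖z‖ ^ 2 : ℝ) : ℂ) := by fun_prop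
    have h2 : Continuous fun z : ℂ => 2 * (starRingEnd ℂ) z :=
      continuous_const.mul Complex.continuous_conj
    exact (h1.continuousOn.mul hf2.continuousOn).sub (h2.continuousOn.mul hc1)
  have e1 := lintegral_ball_sq_norm_of_hasSum hc1 (B := B) (p := fun n r => r ^ n)
    (fun n => by fun_prop) integral_mul_pow_sq (fun r hr θ => ⟨1, by simp, by
      rw [one_mul]
      convert! (hA _ (mul_exp_mem_ball hr θ)).2.1 using 2 with n
      simp only [hB, mul_exp_pow]; push_cast; ring⟩)
  have e2 := lintegral_ball_sq_norm_of_hasSum hc2 (B := B) (p := hessRadial)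
    (fun n => by unfold hessRadial; fun_prop) integral_mul_hessRadial_sq (fun r hr θ =>
      ⟨Complex.exp (θ * Complex.I), Complex.norm_exp_ofReal_mul_I θ, by
        obtain ⟨-, h1, h2⟩ := hA _ (mul_exp_mem_ball hr θ)
        set u := Complex.exp (θ * Complex.I) with hu
        have hun : ‖u‖ = 1 := Complex.norm_exp_ofReal_mul_I θ
        have hun' : u * (starRingEnd ℂ) u = 1 := by
          rw [Complex.mul_conj, Complex.normSq_eq_norm_sq, hun]; simp
        have hnorm : ‖(r * u : ℂ)‖ = r := by simp [hun, abs_of_pos hr.1]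
        have hpow : ∀ n : ℕ, Complex.exp (n * θ * Complex.I) = u ^ n := fun n => by
          rw [hu, ← Complex.exp_nat_mul]; congr 1; ring
        have h3 : HasSum (fun n : ℕ => B n * n * r ^ (n - 1) * u ^ n)
            (u * deriv (deriv f) (r * u)) := by
          rw [← hasSum_nat_add_iff' 1]
          simp only [Finset.range_one, Finset.sum_singleton, Nat.cast_zero, mul_zero, zero_mul,
            sub_zero]
          convert! h2.mul_left u using 2 with n
          simp only [hB, Nat.add_sub_cancel, mul_pow]
          push_cast
          ring
        have h4 := (h3.mul_left (1 - (r : ℂ) ^ 2)).sub (h1.mul_left (2 * (r : ℂ)))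
        convert! h4 using 1
        · funext n
          rw [hpow]
          simp only [hB, hessRadial, mul_pow]
          push_cast
          ring
        · rw [hnorm]
          simp only [map_mul, Complex.conj_ofReal]
          push_cast
          linear_combination (-2 * r * deriv f (r * u)) * hun'⟩)
  have e3 : ∀ n : ℕ, ENNReal.ofReal (2 * π * ‖B n‖ ^ 2 * (1 / (n + 1))) =
      2 * ENNReal.ofReal (2 * π * ‖B n‖ ^ 2 * (1 / (2 * (n + 1)))) := fun n => by
    rw [show (2 : ENNReal) = ENNReal.ofReal 2 by simp, ← ENNReal.ofReal_mul (by norm_num)]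
    congr 1
    field_simp
  have hfin1 : ∫⁻ z in Metric.ball (0 : ℂ) 1, ENNReal.ofReal (‖deriv f z‖ ^ 2) ≠ ⊤ := by
    rw [e1]
    refine Summable.tsum_ofReal_ne_top ?_
    refine Summable.of_nonneg_of_le (fun n => by positivity) (fun n => ?_) (hsq.mul_left (2 * π))
    refine mul_le_of_le_one_right (by positivity) ?_
    rw [div_le_one (by positivity)]
    have : (0 : ℝ) ≤ n := n.cast_nonneg
    linarith
  simp only [e3] at e2
  rw [ENNReal.tsum_mul_left, ← e1] at e2
  have hfin2 := ENNReal.mul_ne_top (ENNReal.ofNat_ne_top (n := 2)) hfin1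
  rw [← e2] at hfin2
  obtain ⟨i1, j1⟩ := integrableOn_and_integral_of_lintegral hc1 hfin1
  obtain ⟨i2, j2⟩ := integrableOn_and_integral_of_lintegral hc2 hfin2
  refine ⟨i2, i1, ?_⟩
  rw [j1, j2, e2, ENNReal.toReal_mul]
  simp

end HypPlane

open HypPlane in
theorem corollary5p3 (a : ℝ) (ha : 0 < a)
    (φ : HypPlane.SphereAtInfinity → ℝ) (hφ : ContMDiff (𝓡 1) 𝓘(ℝ, ℝ) 1 φ)
    (F : HypPlane.E2 → ℝ) (hsmooth : ContDiffOn ℝ ∞ F HypPlane.disk)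
    (hbounded : ∃ C : ℝ, ∀ x ∈ HypPlane.disk, |F x| ≤ C)
    (hharmonic : ∀ x ∈ HypPlane.disk, HypPlane.laplacian (HypPlane.hypMetric a) F x = 0)
    (hboundary : HypPlane.HasBoundaryValues a F φ) :
    MeasureTheory.Integrable
      (fun x => HypPlane.tensorInner (HypPlane.hypMetric a) x
        (HypPlane.covDeriv (HypPlane.hypMetric a) (HypPlane.dForm F) x)
        (HypPlane.covDeriv (HypPlane.hypMetric a) (HypPlane.dForm F) x))
      (HypPlane.riemVolume (HypPlane.hypMetric a) HypPlane.disk) ∧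
    MeasureTheory.Integrable
      (fun x => HypPlane.vecInner (HypPlane.hypMetric a) x
        (HypPlane.grad (HypPlane.hypMetric a) F x) (HypPlane.grad (HypPlane.hypMetric a) F x))
      (HypPlane.riemVolume (HypPlane.hypMetric a) HypPlane.disk) ∧
    ∫ x, HypPlane.tensorInner (HypPlane.hypMetric a) x
        (HypPlane.covDeriv (HypPlane.hypMetric a) (HypPlane.dForm F) x)
        (HypPlane.covDeriv (HypPlane.hypMetric a) (HypPlane.dForm F) x)
      ∂(HypPlane.riemVolume (HypPlane.hypMetric a) HypPlane.disk) =
    a ^ 2 * ∫ x, HypPlane.vecInner (HypPlane.hypMetric a) x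
        (HypPlane.grad (HypPlane.hypMetric a) F x) (HypPlane.grad (HypPlane.hypMetric a) F x)
      ∂(HypPlane.riemVolume (HypPlane.hypMetric a) HypPlane.disk) := by
  obtain ⟨C, hC⟩ := hbounded
  obtain ⟨f, hfa, hfF⟩ :=
    (harmonicOnNhd_comp_planeIso ha hsmooth hharmonic).exists_analyticOnNhd_ball_re_eq
  have hF : ∀ z ∈ Metric.ball (0 : ℂ) 1, F (planeIso z) = (f z).re := fun z hz => (hfF hz).symm
  have hf := hfa.differentiableOn
  have hf1 := hf.deriv Metric.isOpen_ball
  have hd : ∀ z ∈ Metric.ball (0 : ℂ) 1, HasDerivAt f (deriv f z) z := fun z hz =>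
    (hf.differentiableAt (Metric.isOpen_ball.mem_nhds hz)).hasDerivAt
  have hd1 : ∀ z ∈ Metric.ball (0 : ℂ) 1, HasDerivAt (deriv f) (deriv (deriv f) z) z :=
    fun z hz => (hf1.differentiableAt (Metric.isOpen_ball.mem_nhds hz)).hasDerivAt
  have hlim : ∀ θ : ℝ, Filter.Tendsto
      (fun r : ℝ => (f (r * Complex.exp (θ * Complex.I))).re) (nhdsWithin 1 (Set.Iio 1))
      (nhds (φ (boundaryPoint θ))) := by
    intro θ
    refine (tendsto_radial ha hboundary (boundaryPoint θ)).congr' ?_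
    filter_upwards [Ioo_mem_nhdsLT (zero_lt_one (α := ℝ))] with r hr
    rw [← hF _ (mul_exp_mem_ball hr θ), ← Complex.real_smul, map_smul]
    rfl
  have hper : φ (boundaryPoint Real.pi) = φ (boundaryPoint (-Real.pi)) := by
    congr 1
    apply Subtype.ext
    simp [boundaryPoint, Complex.exp_neg]
  obtain ⟨i2, i1, he⟩ := holomorphic_energy_identity hf
    (fun z hz => by rw [← hF z hz]; exact hC _ (planeIso_mem_disk.2 hz))
    (contDiff_comp_boundaryPoint hφ) hper hlim
  obtain ⟨k2, l2⟩ := riemVolume_transfer ha (Φ := fun x => tensorInner (hypMetric a) x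
    (covDeriv (hypMetric a) (dForm F) x) (covDeriv (hypMetric a) (dForm F) x))
    fun z hz => hessian_energy_density ha hF hd hd1 hz
  obtain ⟨k1, l1⟩ := riemVolume_transfer ha (Φ := fun x => vecInner (hypMetric a) x
    (grad (hypMetric a) F x) (grad (hypMetric a) F x)) fun z hz => gradient_energy_density ha hF hd hz
  refine ⟨k2.2 (i2.const_mul _), k1.2 i1, ?_⟩
  rw [l1, l2, MeasureTheory.integral_const_mul, he]
  ring
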